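/- Let $q$ be a power of a prime, let $m\ge 1$, $n=q^{2m}$, and let $P_1,\dots,P_n$ be the points of $\mathbf{F}_{q^2}^m$. For $0\le\nu<m(q^2-1)$ let $\mathcal{R}_{q^2}(\nu,m)\subseteq\mathbf{F}_{q^2}^n$ be the generalized Reed-Muller code consisting of all vectors $(f(P_1),\dots,f(P_n))$ with $f\in\mathbf{F}_{q^2}[x_1,\dots,x_m]$ of total degree at most $\nu$. For a linear code $C\subseteq\mathbf{F}_{q^2}^n$ let $C^\perp$ be its Euclidean dual, let $C|_{\mathbf{F}_q}=C\cap\mathbf{F}_q^n$, and define the Hermitian puncture code $$P_h(C)=\{(\mathrm{tr}_{q^2/q}(a_ib_i^q))_{i=1}^n \mid a,b\in C\}^\perp\subseteq\mathbf{F}_q^n .$$ Let $C=\mathcal{R}_{q^2}(\nu,m)$ with $0\le\nu\le m(q-1)-1$, and let $(q+1)\nu\le\mu\le m(q^2-1)-1$. Then $$P_h(C)\supseteq \mathcal{R}_{q^2}(\mu,m)^\perp|_{\mathbf{F}_q}.$$ Moreover, if $P_h(C)$ contains a vector of Hamming weight $r$, then there exists a quantum stabilizer code with parameters $[[r,\ \ge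 r-2k(\nu),\ \ge d(\nu^\perp)]]_q$, where $$k(\nu)=\sum_{j=0}^m(-1)^j\binom{m}{j}\binom{m+\nu-jq^2}{\nu-jq^2}\qquad\text{and}\qquad d(\nu^\perp)=(R+1)q^{2Q},$$ with $\nu+1=(q^2-1)Q+R$ and $0\le R<q^2-1$ (a binomial coefficient with negative lower entry is $0$). Here an $[[r,k,d]]_q$ stabilizer code is a $q^k$-dimensional subspace of $(\mathbb{C}^q)^{\otimes r}$ that is the joint $+1$-eigenspace of an abelian subgroup of the error group generated by the operators $X(a)Z(b)$, $a,b\in\mathbf{F}_q^r$, and phases, and whose minimum distance $d$ is the least weight of an error that it does not detect; for $k=0$, $d$ is instead the least weight of a nontrivial error $X(a)Z(b)$ whose compression to the code is nonzero. In the degenerate case $r=0$ there is no such error and the minimum distance is taken to be $\infty$. -/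

import Mathlib

noncomputable section

namespace QuantumGRM

/-! ### Classical codes

The coordinates of a generalized Reed-Muller code are indexed by the points of the affine space
`Fin m → K` themselves, so that no enumeration of the points has to be chosen. -/

section Classical

/-- Evaluation of a polynomial in `m` variables at all points of `K ^ m`. -/
def ev (K : Type*) [Field K] (m : ℕ) :
    MvPolynomial (Fin m) K →ₗ[K] ((Fin m → K) → K) where
  toFun f := fun P => MvPolynomial.eval P f
  map_add' f g := by ext P; simp
  map_smul' c f := by ext P; simp

/-- The generalized Reed-Muller code of order `ν` over the finite field `K`: the evaluations of
all polynomials in `m` variables of total degree at most `ν`. -/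
def grm (K : Type*) [Field K] (ν m : ℕ) : Submodule K ((Fin m → K) → K) :=
  (MvPolynomial.restrictTotalDegree (Fin m) K ν).map (ev K m)

/-- The Euclidean dual of a set of vectors. -/
def dual {F ι : Type*} [Field F] [Fintype ι] (S : Set (ι → F)) : Submodule F (ι → F) where
  carrier := {x | ∀ s ∈ S, ∑ i, x i * s i = 0}
  zero_mem' := by intro s _; simp
  add_mem' := by
    intro x y hx hy s hs
    simp [add_mul, Finset.sum_add_distrib, hx s hs, hy s hs]
  smul_mem' := by
    intro c x hx s hs
    simp [mul_assoc, ← Finset.mul_sum, hx s hs]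

/-- The subfield subcode `C|_F`: the vectors with entries in the subfield `F` that lie in `C`. -/
def subfieldSubcode (F : Type*) {K ι : Type*} [Field F] [Field K] [Algebra F K]
    (C : Submodule K (ι → K)) : Submodule F (ι → F) :=
  (C.restrictScalars F).comap ((Algebra.linearMap F K).compLeft ι)

/-- The Hermitian puncture code of `C`: the Euclidean dual, in `F ^ ι`, of the set of all vectors
`tr_{K/F}(a i * b i ^ q)` with `a, b ∈ C`, where `q` is the cardinality of `F`. -/
def hermitianPunctureCode (F : Type*) {K ι : Type*} [Field F] [Fintype F] [Field K] [Algebra F K]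
    [Fintype ι] (C : Submodule K (ι → K)) : Submodule F (ι → F) :=
  dual {x | ∃ a ∈ C, ∃ b ∈ C, x = fun i => Algebra.trace F K (a i * b i ^ Fintype.card F)}

/-- The closed formula for the dimension `k(ν)` of the generalized Reed-Muller code of order `ν` in
`m` variables over a field with `Q` elements; a binomial coefficient with negative lower entry is zero. -/
def grmDim (Q m ν : ℕ) : ℤ :=
  ∑ j ∈ Finset.range (m + 1), (-1) ^ j * (m.choose j : ℤ) *
    (if j * Q ≤ ν then ((m + ν - j * Q).choose (ν - j * Q) : ℤ) else 0)

/-- The closed formula for the minimum distance `d(ν)` of the generalized Reed-Muller code of order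
`ν < m (Q - 1)` in `m` variables over a field with `Q` elements: `(R + 1) Q ^ T`, where
`m (Q - 1) - ν = (Q - 1) T + R` and `0 ≤ R < Q - 1`. -/
def grmDist (Q m ν : ℕ) : ℕ :=
  ((m * (Q - 1) - ν) % (Q - 1) + 1) * Q ^ ((m * (Q - 1) - ν) / (Q - 1))

/-- The order `ν^⊥` of the dual of the generalized Reed-Muller code of order `ν`. -/
def dualOrder (Q m ν : ℕ) : ℕ := m * (Q - 1) - 1 - ν

end Classical

/-! ### Quantum stabilizer codes -/

section Quantum

/-- The Hilbert space of `n` qudits, with orthonormal basis indexed by the vectors of `F ^ n`. -/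
abbrev QSpace (F : Type*) (n : ℕ) : Type _ := EuclideanSpace ℂ (Fin n → F)

variable (p : ℕ) [Fact p.Prime] {F : Type*} [Field F] [Algebra (ZMod p) F] {n : ℕ}

/-- The additive character `x ↦ exp (2 π i tr(x) / p)` of `F`, with `tr` the absolute trace. -/
def chi (x : F) : ℂ := ZMod.stdAddChar (Algebra.trace (ZMod p) F x)

/-- The error operator `X(a) Z(b)`, which maps the basis state `x` to `chi (b ⬝ x)` times the
basis state `x + a`. -/
def errorOp (a b : Fin n → F) : QSpace F n →ₗ[ℂ] QSpace F n where
  toFun ψ := WithLp.toLp 2 fun x => chi p (∑ i, b i * (x i - a i)) * ψ (x - a)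
  map_add' ψ φ := by ext x; simp [mul_add]
  map_smul' c ψ := by ext x; simp [mul_left_comm]

/-- The phases of the error group: the `p`-th roots of unity, and for `p = 2` also `i` and `-i`. -/
def IsPhase (c : ℂ) : Prop := c ^ (if p = 2 then 4 else p) = 1

/-- `g` belongs to the error group on `n` qudits. -/
def IsError (g : QSpace F n ≃ₗ[ℂ] QSpace F n) : Prop :=
  ∃ (c : ℂ) (a b : Fin n → F), IsPhase p c ∧ ∀ v, g v = c • errorOp p a b v

open Classical in
/-- The weight of the error `X(a) Z(b)`: the number of qudits on which it is not a scalar. -/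
def errorWeight (a b : Fin n → F) : ℕ :=
  (Finset.univ.filter fun i => a i ≠ 0 ∨ b i ≠ 0).card

/-- `Q` is a stabilizer code: a nonzero space that is the joint eigenspace with eigenvalue `1` of
an abelian subgroup of the error group. -/
def IsStabilizerCode (Q : Submodule ℂ (QSpace F n)) : Prop :=
  Q ≠ ⊥ ∧ ∃ S : Subgroup (QSpace F n ≃ₗ[ℂ] QSpace F n),
    (∀ g ∈ S, IsError p g) ∧ (∀ g ∈ S, ∀ h ∈ S, g * h = h * g) ∧
    ∀ v, v ∈ Q ↔ ∀ g ∈ S, g v = v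

variable [Fintype F]

/-- `Q` detects the error `X(a) Z(b)`: the compression of the error to `Q` is a scalar. -/
def Detects (Q : Submodule ℂ (QSpace F n)) (a b : Fin n → F) : Prop :=
  ∃ c : ℂ, ∀ u ∈ Q, ∀ v ∈ Q, inner ℂ u (errorOp p a b v) = c * inner ℂ u v

/-- The compression of the error `X(a) Z(b)` to `Q` is zero. -/
def Annihilates (Q : Submodule ℂ (QSpace F n)) (a b : Fin n → F) : Prop :=
  ∀ u ∈ Q, ∀ v ∈ Q, inner ℂ u (errorOp p a b v) = 0

/-- The errors that count for the minimum distance: the undetectable ones. As a code of dimension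
one detects every error, the usual convention is made there (such a code has to be pure): what
counts are the nontrivial errors whose compression to the code does not vanish. -/
def IsBadError (Q : Submodule ℂ (QSpace F n)) (a b : Fin n → F) : Prop :=
  (Module.finrank ℂ Q ≠ 1 ∧ ¬ Detects p Q a b) ∨
  (Module.finrank ℂ Q = 1 ∧ (a ≠ 0 ∨ b ≠ 0) ∧ ¬ Annihilates p Q a b)

/-- The minimum distance of a quantum code: the least weight of an error that counts (`⊤` if
there is none, which for a nonzero code happens only in length `0`). -/
def minDist (Q : Submodule ℂ (QSpace F n)) : ℕ∞ :=
  ⨅ (a : Fin n → F) (b : Fin n → F) (_ : IsBadError p Q a b), (errorWeight a b : ℕ∞)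

variable (F n) in
/-- There is an `[[n, k, d]]_q` stabilizer code, where `q` is the cardinality of `F`. -/
def ExistsStabilizerCode (k : ℕ) (d : ℕ∞) : Prop :=
  ∃ Q : Submodule ℂ (QSpace F n), IsStabilizerCode p Q ∧
    Module.finrank ℂ Q = Fintype.card F ^ k ∧ minDist p Q = d

end Quantum

end QuantumGRM

end

/-!
Put `K = 𝔽_{q²}`, `F = 𝔽_q` and let `C` be the generalized Reed-Muller code of order `ν` over `K`.

The inclusion holds because `a * b ^ q` is a word of order at most `(q + 1) ν` whenever `a` and `b`
are words of order at most `ν`.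

Let `x` be a word of weight `r` in the puncture code. As `C` is linear over `K`, the traces in the
definition of the puncture code can be dropped: `∑ x_i a_i b_i ^ q = 0` for all `a, b ∈ C`. The norm
from `K` to `F` is surjective, so `x_i = c_i ^ (q + 1)` on the support of `x`, and the words
`(c_i a_i)` form a code `C'` of length `r` which is self-orthogonal for the Hermitian form. Writing
`K = F ⊕ F θ` turns `C'` into a subspace of `F ^ r × F ^ r` which is isotropic for the symplectic form
(`hermitian_sub_conj`), that is, into a set `D` of commuting errors.

The stabilizer group is found without a choice of phases by hand: the operators in `D` have a joint
eigenvector `ψ` (`exists_joint_eigenvector`), and dividing each of them by its eigenvalue on `ψ` gives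
a linear representation of `D` which fixes `ψ`. Its space of invariants is the quantum code. Nontrivial
errors have trace zero, so by character theory the dimension is `q ^ r / |D| = q ^ (r - 2 dim C')`.
An error that does not commute with all of `D` has compression zero, so any error that counts for
the minimum distance comes from the Hermitian dual of `C'`, hence from a word of the same weight in
the Euclidean dual of `C`.

Two classical facts remain. The dimension of `C` is at most the number of reduced monomials of degree
at most `ν`, which is computed by a generating function (`card_reducedExponents`). The words in the
dual of `C` have weight at least `(R + 1) q ^ (2 T)`, with `ν + 1 = (q² - 1) T + R`, because on any
smaller nonempty set of points a polynomial of degree at most `ν` vanishes at all points but one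
(`exists_separating`); this goes by induction on the number of variables.
-/

noncomputable section

namespace QuantumGRM

/-! ### Separating points by polynomials of bounded degree -/

/-- The number `(R + 1) * Q ^ T`, where `t = (Q - 1) * T + R` with `0 ≤ R < Q - 1`: a lower
bound for the minimum distance of the dual of the generalized Reed-Muller code of order `t - 1`. -/
def sepBound (Q t : ℕ) : ℕ := (t % (Q - 1) + 1) * Q ^ (t / (Q - 1))

lemma sepBound_add {Q T R : ℕ} (hR : R < Q - 1) :
    sepBound Q ((Q - 1) * T + R) = (R + 1) * Q ^ T := by
  have h0 : 0 < Q - 1 := by omega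
  unfold sepBound
  rw [Nat.mul_add_mod, Nat.mod_eq_of_lt hR, Nat.mul_add_div h0, Nat.div_eq_of_lt hR, add_zero]

lemma sepBound_zero (Q : ℕ) : sepBound Q 0 = 1 := by simp [sepBound]

/-- The inequality that drives the induction on the number of variables in `exists_separating`:
removing `k - 1` of `k` parallel hyperplanes costs degree `k - 1` and leaves a slice with at most a
`k`-th part of the points. -/
lemma sepBound_le_mul {Q t k : ℕ} (hQ : 2 ≤ Q) (hk : 1 ≤ k) (hkQ : k ≤ Q) (hkt : k ≤ t + 1) :
    sepBound Q t ≤ k * sepBound Q (t + 1 - k) := by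
  have h0 : 0 < Q - 1 := by omega
  obtain ⟨T, R, hR, rfl⟩ : ∃ T R, R < Q - 1 ∧ t = (Q - 1) * T + R :=
    ⟨t / (Q - 1), t % (Q - 1), Nat.mod_lt _ h0, (Nat.div_add_mod _ _).symm⟩
  rw [sepBound_add hR]
  by_cases h : k ≤ R + 1
  · obtain ⟨e, he⟩ := Nat.exists_eq_add_of_le h
    obtain ⟨j, rfl⟩ := Nat.exists_eq_add_of_le hk
    have : (Q - 1) * T + R + 1 - (1 + j) = (Q - 1) * T + e := by omega
    rw [this, sepBound_add (by omega), ← mul_assoc]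
    refine Nat.mul_le_mul_right _ ?_
    rw [he]
    nlinarith [Nat.zero_le (j * e)]
  · obtain _ | T := T
    · omega
    obtain ⟨e, rfl⟩ := Nat.exists_eq_add_of_le hkQ
    obtain ⟨j, rfl⟩ := Nat.exists_eq_add_of_le (by omega : R + 1 ≤ k)
    have : (R + 1 + j + e - 1) * (T + 1) + R + 1 - (R + 1 + j) =
        (R + 1 + j + e - 1) * T + (R + e) := by
      rw [Nat.mul_succ]; omega
    rw [this, sepBound_add (by omega), pow_succ, mul_comm (_ ^ T), ← mul_assoc, ← mul_assoc]
    refine Nat.mul_le_mul_right _ ?_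
    nlinarith [Nat.zero_le (j * e)]

lemma le_of_lt_sepBound {Q t k : ℕ} (hkQ : k ≤ Q) (hk : k < sepBound Q t) : k ≤ t + 1 := by
  by_cases h : t < Q - 1
  · have := sepBound_add (Q := Q) (T := 0) h
    simp at this
    omega
  · omega

open MvPolynomial in
/-- A nonempty set of fewer than `sepBound Q t` points contains a point that a polynomial of degree
less than `t` separates from the others. The smallest nonempty slice by a coordinate hyperplane is
treated by induction, and the other slices are removed by linear factors. -/
theorem exists_separating {K : Type*} [Field K] [Fintype K] (m t : ℕ)
    (S : Finset (Fin m → K)) (hS : S.Nonempty) (hcard : S.card < sepBound (Fintype.card K) t) :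
    ∃ P ∈ S, ∃ f : MvPolynomial (Fin m) K, f.totalDegree + 1 ≤ t ∧ eval P f ≠ 0 ∧
      ∀ P' ∈ S, P' ≠ P → eval P' f = 0 := by
  classical
  induction m generalizing t with
  | zero =>
    obtain ⟨P, hP⟩ := hS
    refine ⟨P, hP, 1, ?_, by simp, fun P' _ h => absurd (Subsingleton.elim _ _) h⟩
    rcases Nat.eq_zero_or_pos t with rfl | ht
    · rw [sepBound_zero] at hcard
      have := Finset.card_pos.2 ⟨P, hP⟩
      omega
    · simpa using Nat.succ_le_of_lt ht
  | succ m ih =>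
    set A : Finset K := S.image (fun P => P 0) with hA
    have hAne : A.Nonempty := hS.image _
    set slice : K → Finset (Fin (m + 1) → K) := fun c => S.filter fun P => P 0 = c with hslice
    have hsum : S.card = ∑ c ∈ A, (slice c).card :=
      Finset.card_eq_sum_card_fiberwise fun P hP => Finset.mem_image_of_mem _ hP
    -- The slice at `c` is a smallest nonempty one.
    obtain ⟨c, hcA, hc⟩ := Finset.exists_min_image A (fun c => (slice c).card) hAne
    have hmul : A.card * (slice c).card ≤ S.card := by
      rw [hsum, ← smul_eq_mul]
      exact Finset.card_nsmul_le_sum _ _ _ hc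
    have hA1 : 1 ≤ A.card := hAne.card_pos
    have hAQ : A.card ≤ Fintype.card K := Finset.card_le_univ A
    have hAt : A.card ≤ t + 1 :=
      le_of_lt_sepBound hAQ (Finset.card_image_le.trans_lt hcard)
    have hlt : (slice c).card < sepBound (Fintype.card K) (t + 1 - A.card) :=
      lt_of_mul_lt_mul_left (hmul.trans_lt (hcard.trans_le
        (sepBound_le_mul Fintype.one_lt_card hA1 hAQ hAt))) (Nat.zero_le _)
    have hinj : Set.InjOn (Fin.tail : (Fin (m + 1) → K) → Fin m → K) (slice c) := by
      intro P hP P' hP' h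
      rw [← Fin.cons_self_tail P, ← Fin.cons_self_tail P', h]
      have h1 : P 0 = c := (Finset.mem_filter.1 hP).2
      have h2 : P' 0 = c := (Finset.mem_filter.1 hP').2
      rw [h1, h2]
    have hne : (slice c).Nonempty := by
      obtain ⟨P, hP, rfl⟩ := Finset.mem_image.1 hcA
      exact ⟨P, Finset.mem_filter.2 ⟨hP, rfl⟩⟩
    obtain ⟨p, hp, f, hdeg, hf, hf0⟩ := ih (t + 1 - A.card) ((slice c).image Fin.tail)
      (hne.image _) (by rwa [Finset.card_image_of_injOn hinj])
    obtain ⟨P, hP, rfl⟩ := Finset.mem_image.1 hp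
    have hPS := (Finset.mem_filter.1 hP).1
    have hPc : P 0 = c := (Finset.mem_filter.1 hP).2
    refine ⟨P, hPS, rename Fin.succ f * ∏ a ∈ A.erase c, (X 0 - C a), ?_, ?_, ?_⟩
    · have h1 : (rename Fin.succ f : MvPolynomial (Fin (m + 1)) K).totalDegree ≤ f.totalDegree :=
        totalDegree_rename_le _ _
      have h2 : (∏ a ∈ A.erase c, (X 0 - C a : MvPolynomial (Fin (m + 1)) K)).totalDegree ≤
          A.card - 1 := by
        refine (totalDegree_finsetProd _ _).trans ?_
        rw [← Finset.card_erase_of_mem hcA, Finset.card_eq_sum_ones]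
        refine Finset.sum_le_sum fun a _ => ?_
        exact (totalDegree_sub_C_le _ _).trans (totalDegree_X _).le
      have h3 := totalDegree_mul (rename Fin.succ f)
        (∏ a ∈ A.erase c, (X 0 - C a : MvPolynomial (Fin (m + 1)) K))
      omega
    · rw [map_mul, eval_rename, map_prod]
      refine mul_ne_zero hf (Finset.prod_ne_zero_iff.2 fun a ha => ?_)
      simpa [hPc, sub_ne_zero] using (Finset.ne_of_mem_erase ha).symm
    · intro P' hP' hne'
      rw [map_mul, eval_rename, map_prod]
      by_cases h : P' 0 = c
      · have hP'c : P' ∈ slice c := Finset.mem_filter.2 ⟨hP', h⟩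
        have := hf0 (Fin.tail P') (Finset.mem_image_of_mem _ hP'c)
          fun h' => hne' (hinj hP'c hP h')
        exact mul_eq_zero_of_left this _
      · refine mul_eq_zero_of_right _ (Finset.prod_eq_zero
          (Finset.mem_erase.2 ⟨h, Finset.mem_image_of_mem _ hP'⟩) ?_)
        simp

/-- The nonzero words that are orthogonal to the generalized Reed-Muller code restricted to the
points `pts i` have weight at least `sepBound`; for `pts` a bijection this bounds the minimum distance
of the dual code. -/
theorem sepBound_le_card {K ι : Type*} [Field K] [Fintype K] [Fintype ι] [DecidableEq K]
    {m ν : ℕ} {pts : ι → Fin m → K} (hpts : Function.Injective pts) {y : ι → K} (hy0 : y ≠ 0)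
    (hy : ∀ s ∈ grm K ν m, ∑ i, s (pts i) * y i = 0) :
    sepBound (Fintype.card K) (ν + 1) ≤ (Finset.univ.filter fun i => y i ≠ 0).card := by
  classical
  by_contra! h
  have hne : (Finset.univ.filter fun i => y i ≠ 0).Nonempty := by
    obtain ⟨i, hi⟩ := Function.ne_iff.1 hy0
    exact ⟨i, by simpa using hi⟩
  obtain ⟨P, hP, f, hdeg, hf, hf0⟩ := exists_separating m (ν + 1) _ (hne.image pts)
    (by rwa [Finset.card_image_of_injective _ hpts])
  obtain ⟨i, hi, rfl⟩ := Finset.mem_image.1 hP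
  have hsum := hy (ev K m f)
    ⟨f, by simpa [MvPolynomial.mem_restrictTotalDegree] using hdeg, rfl⟩
  rw [Finset.sum_eq_single i] at hsum
  · exact mul_ne_zero hf (Finset.mem_filter.1 hi).2 hsum
  · intro j _ hne'
    by_cases hz : y j = 0
    · simp [hz]
    · exact mul_eq_zero_of_left (hf0 (pts j) (Finset.mem_image_of_mem _ (by simpa using hz))
        (hpts.ne hne')) _
  · simp

lemma grmDist_dualOrder {Q m ν : ℕ} (h : ν + 1 ≤ m * (Q - 1)) :
    grmDist Q m (dualOrder Q m ν) = sepBound Q (ν + 1) := by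
  have : m * (Q - 1) - dualOrder Q m ν = ν + 1 := by unfold dualOrder; omega
  rw [grmDist, this, sepBound]

/-! ### The dimension of generalized Reed-Muller codes -/

/-- The exponents of the reduced monomials of degree at most `ν` in `m` variables: those in which
every variable occurs to a power less than `Q`. -/
def reducedExponents (Q m ν : ℕ) : Finset (Fin m → ℕ) :=
  (Fintype.piFinset fun _ => Finset.range Q).filter fun e => ∑ i, e i ≤ ν

/-- As functions on `K`, all powers are reduced ones, of no larger degree, by `x ^ Q = x`. -/
lemma exists_reduced_pow {K : Type*} [Field K] [Fintype K] (e : ℕ) :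
    ∃ e' < Fintype.card K, e' ≤ e ∧ ∀ x : K, x ^ e' = x ^ e := by
  induction e using Nat.strong_induction_on with
  | _ e ih =>
    have h1 : 1 < Fintype.card K := Fintype.one_lt_card
    by_cases h : e < Fintype.card K
    · exact ⟨e, h, le_rfl, fun _ => rfl⟩
    · push Not at h
      obtain ⟨e', h', hle, hx⟩ := ih (e - Fintype.card K + 1) (by omega)
      refine ⟨e', h', by omega, fun x => ?_⟩
      conv_rhs => rw [← Nat.sub_add_cancel h, pow_add, FiniteField.pow_card]
      rw [hx, pow_succ]

lemma finrank_grm_le_card {K : Type*} [Field K] [Fintype K] (m ν : ℕ) :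
    Module.finrank K (grm K ν m) ≤ (reducedExponents (Fintype.card K) m ν).card := by
  classical
  set g : (Fin m → ℕ) → (Fin m → K) → K := fun e P => ∏ i, P i ^ e i with hg
  have hle : grm K ν m ≤
      Submodule.span K ((reducedExponents (Fintype.card K) m ν).image g : Set ((Fin m → K) → K)) := by
    rintro _ ⟨f, hf, rfl⟩
    have hf' : f.totalDegree ≤ ν := by
      simpa [MvPolynomial.mem_restrictTotalDegree] using hf
    have : ev K m f = ∑ s ∈ f.support, f.coeff s • g s := by
      ext P
      simp only [ev, LinearMap.coe_mk, AddHom.coe_mk, MvPolynomial.eval_eq', Finset.sum_apply,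
        Pi.smul_apply, smul_eq_mul, hg]
    rw [this]
    refine Submodule.sum_mem _ fun s hs => Submodule.smul_mem _ _ (Submodule.subset_span ?_)
    choose r hr hrle hrx using exists_reduced_pow (K := K)
    refine Finset.mem_coe.2 (Finset.mem_image.2 ⟨fun i => r (s i), ?_, ?_⟩)
    · refine Finset.mem_filter.2 ⟨by simp [hr], ?_⟩
      refine (Finset.sum_le_sum fun i _ => hrle (s i)).trans (le_trans ?_ hf')
      have := MvPolynomial.le_totalDegree hs
      rwa [Finsupp.sum_fintype _ _ (fun _ => rfl)] at this
    · ext P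
      simp [hg, hrx]
  refine (Submodule.finrank_mono hle).trans ?_
  exact (finrank_span_finset_le_card _).trans Finset.card_image_le

open PowerSeries in
/-- Both sides are the coefficient of `X ^ ν` in `(1 - X ^ Q) ^ m / (1 - X) ^ (m + 1)`. -/
lemma card_reducedExponents (Q m ν : ℕ) :
    ((reducedExponents Q m ν).card : ℤ) = grmDim Q m ν := by
  have hone : (1 - X : ℤ⟦X⟧) * mk 1 = 1 := by rw [mul_comm, mk_one_mul_one_sub_eq_one]
  have hG : (1 - X ^ Q : ℤ⟦X⟧) ^ m * (mk 1) ^ (m + 1) =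
      ∑ e ∈ Fintype.piFinset fun _ : Fin m => Finset.range Q, X ^ (∑ i, e i) * mk 1 := by
    rw [← Finset.sum_mul]
    simp_rw [← Finset.prod_pow_eq_pow_sum]
    rw [← Finset.prod_univ_sum (fun _ => Finset.range Q) (fun _ j => (X : ℤ⟦X⟧) ^ j),
      Finset.prod_const, Finset.card_univ, Fintype.card_fin, ← mul_neg_geom_sum, mul_pow, pow_succ]
    calc _ = (∑ i ∈ Finset.range Q, X ^ i : ℤ⟦X⟧) ^ m * (((1 - X) * mk 1) ^ m * mk 1) := by
          rw [mul_pow]; ring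
      _ = _ := by rw [hone, one_pow, one_mul]
  have hl : ((reducedExponents Q m ν).card : ℤ) =
      coeff ν ((1 - X ^ Q : ℤ⟦X⟧) ^ m * (mk 1) ^ (m + 1)) := by
    rw [hG, map_sum, reducedExponents, Finset.card_filter, Nat.cast_sum]
    refine Finset.sum_congr rfl fun e _ => ?_
    rw [coeff_X_pow_mul']
    simp
  rw [hl, grmDim, mk_one_pow_eq_mk_choose_add, sub_eq_add_neg, add_comm, add_pow, Finset.sum_mul,
    map_sum]
  refine Finset.sum_congr rfl fun j _ => ?_
  have : (-X ^ Q : ℤ⟦X⟧) ^ j * 1 ^ (m - j) * (m.choose j : ℤ⟦X⟧) * (mk fun n ↦ ((m + n).choose m : ℤ))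
      = C ((-1) ^ j * (m.choose j : ℤ)) * (X ^ (j * Q) * mk fun n ↦ ((m + n).choose m : ℤ)) := by
    rw [neg_pow, ← pow_mul, mul_comm Q j]
    simp
    ring
  rw [this, coeff_C_mul, coeff_X_pow_mul']
  congr 1
  split_ifs with h
  · rw [coeff_mk, Nat.add_sub_assoc h, Nat.choose_symm_add]
  · rfl

/-! ### The error operators and their commutation relations -/

section Weyl

variable (p : ℕ) [Fact p.Prime] {F : Type*} [Field F] [Algebra (ZMod p) F] {n : ℕ}

lemma chi_zero : chi p (0 : F) = 1 := by simp [chi]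

lemma chi_add (x y : F) : chi p (x + y) = chi p x * chi p y := by
  simp [chi, AddChar.map_add_eq_mul]

lemma chi_nsmul (k : ℕ) (x : F) : chi p (k • x) = chi p x ^ k := by
  simp [chi, AddChar.map_nsmul_eq_pow, -nsmul_eq_mul]

lemma chi_pow_of_dvd {k : ℕ} (hk : p ∣ k) (x : F) : chi p x ^ k = 1 := by
  rw [chi, ← AddChar.map_nsmul_eq_pow]
  have : k • (Algebra.trace (ZMod p) F x) = 0 := by
    rw [nsmul_eq_mul, (ZMod.natCast_eq_zero_iff k p).2 hk, zero_mul]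
  rw [this, AddChar.map_zero_eq_one]

lemma norm_chi (x : F) : ‖chi p x‖ = 1 := AddChar.norm_apply _ _

lemma chi_ne_zero (x : F) : chi p x ≠ 0 := norm_ne_zero_iff.1 (by simp [norm_chi])

lemma chi_eq_one_iff (x : F) : chi p x = 1 ↔ Algebra.trace (ZMod p) F x = 0 := by
  rw [chi, ← AddChar.map_zero_eq_one (ZMod.stdAddChar (N := p)), ZMod.injective_stdAddChar.eq_iff]

/-- The symplectic form on `F ^ n × F ^ n` which governs the commutation of the errors
`X(a) Z(b)`. -/
def symp (u v : (Fin n → F) × (Fin n → F)) : F :=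
  ∑ i, u.2 i * v.1 i - ∑ i, v.2 i * u.1 i

/-- The error `X(a) Z(b)` attached to the pair `(a, b)`. -/
def weyl (u : (Fin n → F) × (Fin n → F)) : Module.End ℂ (QSpace F n) := errorOp p u.1 u.2

lemma weyl_apply (u : (Fin n → F) × (Fin n → F)) (ψ : QSpace F n) (x : Fin n → F) :
    weyl p u ψ x = chi p (∑ i, u.2 i * (x i - u.1 i)) * ψ (x - u.1) := rfl

lemma weyl_zero : weyl p (0 : (Fin n → F) × (Fin n → F)) = 1 := by
  ext ψ x
  simp [weyl_apply, chi_zero]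

lemma weyl_mul (u v : (Fin n → F) × (Fin n → F)) :
    weyl p u * weyl p v = chi p (∑ i, u.2 i * v.1 i) • weyl p (u + v) := by
  ext ψ x
  simp only [Module.End.mul_apply, LinearMap.smul_apply, PiLp.smul_apply, weyl_apply, smul_eq_mul,
    ← mul_assoc, ← chi_add, ← Finset.sum_add_distrib, Prod.fst_add, Prod.snd_add, Pi.add_apply,
    Pi.sub_apply, sub_sub]
  congr 2
  refine Finset.sum_congr rfl fun i _ => ?_
  ring

lemma weyl_mul_comm (u v : (Fin n → F) × (Fin n → F)) :
    weyl p u * weyl p v = chi p (symp u v) • (weyl p v * weyl p u) := by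
  rw [weyl_mul, weyl_mul, smul_smul, ← chi_add, add_comm v u, symp, sub_add_cancel]

lemma weyl_pow (u : (Fin n → F) × (Fin n → F)) (k : ℕ) :
    weyl p u ^ k = chi p (∑ i, u.2 i * u.1 i) ^ (k.choose 2) • weyl p (k • u) := by
  induction k with
  | zero => simp [weyl_zero]
  | succ k ih =>
    rw [pow_succ', ih, mul_smul_comm, weyl_mul, smul_smul, Nat.choose_succ_succ' k 1,
      Nat.choose_one_right, pow_add, mul_comm (_ ^ k), succ_nsmul' u]
    congr 2
    rw [← chi_nsmul, Finset.smul_sum]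
    congr 1
    refine Finset.sum_congr rfl fun i _ => ?_
    simp
    ring

/-- The order of the group of phases. It is `4` for `p = 2`, as the square of `X(a) Z(b)` may then
be `-1`. -/
def phaseOrder : ℕ := if p = 2 then 4 else p

lemma phaseOrder_ne_zero : phaseOrder p ≠ 0 := by
  unfold phaseOrder
  have := (Fact.out : p.Prime).ne_zero
  split_ifs <;> simp [this]

lemma dvd_phaseOrder : p ∣ phaseOrder p := by
  unfold phaseOrder
  split_ifs with h
  · subst h; decide
  · rfl

lemma dvd_choose_phaseOrder : p ∣ (phaseOrder p).choose 2 := by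
  have hp : p.Prime := Fact.out
  unfold phaseOrder
  split_ifs with h
  · subst h; decide
  · exact hp.dvd_choose_self two_ne_zero (lt_of_le_of_ne hp.two_le (Ne.symm h))

/-- The scalar in `weyl_pow` is trivial, as `p` divides `N.choose 2` for `N = p` odd and also for
`p = 2`, `N = 4`. -/
lemma weyl_pow_phaseOrder (u : (Fin n → F) × (Fin n → F)) : weyl p u ^ phaseOrder p = 1 := by
  have hu : phaseOrder p • u = 0 := by
    have : CharP F p := charP_of_injective_algebraMap (algebraMap (ZMod p) F).injective p
    have h0 : (phaseOrder p : F) = 0 := (CharP.cast_eq_zero_iff F p _).2 (dvd_phaseOrder p)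
    ext i <;> simp [h0]
  rw [weyl_pow, chi_pow_of_dvd p (dvd_choose_phaseOrder p), hu, weyl_zero, one_smul]

variable [Fintype F]

lemma inner_weyl_weyl (u : (Fin n → F) × (Fin n → F)) (ψ φ : QSpace F n) :
    inner ℂ (weyl p u ψ) (weyl p u φ) = inner ℂ ψ φ := by
  rw [PiLp.inner_apply, PiLp.inner_apply,
    ← (Equiv.subRight u.1).sum_comp fun x => inner ℂ (ψ x) (φ x)]
  refine Finset.sum_congr rfl fun x _ => ?_
  simp only [weyl_apply, Equiv.subRight_apply, RCLike.inner_apply, map_mul]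
  have : chi p (∑ i, u.2 i * (x i - u.1 i)) *
      (starRingEnd ℂ) (chi p (∑ i, u.2 i * (x i - u.1 i))) = 1 := by
    rw [Complex.mul_conj, Complex.normSq_eq_norm_sq, norm_chi]; simp
  linear_combination (φ (x - u.1) * (starRingEnd ℂ) (ψ (x - u.1))) * this

/-- The symplectic form is nondegenerate, also after composition with `chi`. -/
lemma exists_chi_symp_ne_one {u : (Fin n → F) × (Fin n → F)} (hu : u ≠ 0) :
    ∃ v, chi p (symp v u) ≠ 1 := by
  classical
  have key (y : F) (hy : y ≠ 0) : ∃ x : F, chi p (x * y) ≠ 1 := by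
    have : FiniteDimensional (ZMod p) F := Module.Finite.of_finite
    by_contra! h
    refine hy ((traceForm_nondegenerate (ZMod p) F).2 y fun x => ?_)
    exact (chi_eq_one_iff p _).1 (h x)
  by_cases h1 : u.1 = 0
  · have h2 : u.2 ≠ 0 := fun h2 => hu (Prod.ext h1 h2)
    obtain ⟨i, hi⟩ := Function.ne_iff.1 h2
    obtain ⟨x, hx⟩ := key (-u.2 i) (neg_ne_zero.2 hi)
    refine ⟨(Pi.single i x, 0), ?_⟩
    simpa [symp, Pi.single_apply, mul_comm] using hx
  · obtain ⟨i, hi⟩ := Function.ne_iff.1 h1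
    obtain ⟨x, hx⟩ := key (u.1 i) hi
    refine ⟨(0, Pi.single i x), ?_⟩
    simpa [symp, Pi.single_apply] using hx

lemma trace_weyl {u : (Fin n → F) × (Fin n → F)} (hu : u ≠ 0) :
    LinearMap.trace ℂ _ (weyl p u) = 0 := by
  obtain ⟨v, hv⟩ := exists_chi_symp_ne_one p hu
  -- Conjugation by `weyl p v` multiplies `weyl p u` by a scalar other than one.
  have hvu := weyl_mul_comm p v u
  set N := phaseOrder p with hN
  have hpow : weyl p v * weyl p v ^ (N - 1) = 1 := by
    rw [← pow_succ', Nat.sub_add_cancel (Nat.pos_of_ne_zero (phaseOrder_ne_zero p)),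
      weyl_pow_phaseOrder]
  have h1 : LinearMap.trace ℂ _ (weyl p v * weyl p u * weyl p v ^ (N - 1)) =
      LinearMap.trace ℂ _ (weyl p u) := by
    rw [LinearMap.trace_mul_comm, ← mul_assoc, ← pow_succ, Nat.sub_add_cancel
      (Nat.pos_of_ne_zero (phaseOrder_ne_zero p)), weyl_pow_phaseOrder, one_mul]
  rw [hvu, smul_mul_assoc, mul_assoc, hpow, mul_one, map_smul, smul_eq_mul] at h1
  have h2 : (chi p (symp v u) - 1) * LinearMap.trace ℂ _ (weyl p u) = 0 := by
    linear_combination h1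
  exact (mul_eq_zero.1 h2).resolve_left (sub_ne_zero.2 hv)

end Weyl

/-- A family of commuting operators of finite order on a nonzero complex vector space of finite
dimension has a joint eigenvector. -/
lemma exists_joint_eigenvector {ι V : Type*} [AddCommGroup V] [Module ℂ V] [FiniteDimensional ℂ V]
    [Nontrivial V] (f : ι → Module.End ℂ V) (hf : ∀ i j, Commute (f i) (f j)) {N : ℕ} (hN : N ≠ 0)
    (hfN : ∀ i, f i ^ N = 1) : ∃ (ψ : V) (l : ι → ℂ), ψ ≠ 0 ∧ ∀ i, f i ψ = l i • ψ := by
  have htop := Module.End.iSup_iInf_maxGenEigenspace_eq_top_of_iSup_maxGenEigenspace_eq_top_of_commute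
    f (fun i j _ => hf i j) fun i => Module.End.iSup_maxGenEigenspace_eq_top (f i)
  obtain ⟨l, hl⟩ : ∃ l : ι → ℂ, ⨅ i, (f i).maxGenEigenspace (l i) ≠ ⊥ := by
    by_contra! h
    simp [h] at htop
  obtain ⟨ψ, hψ, hψ0⟩ := Submodule.exists_mem_ne_zero_of_ne_bot hl
  refine ⟨ψ, l, hψ0, fun i => ?_⟩
  have hss : (f i).IsSemisimple := by
    refine Module.End.isSemisimple_of_squarefree_aeval_eq_zero
      (p := (Polynomial.X ^ N - 1 : Polynomial ℂ)) ?_ (by simp [hfN i])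
    exact (Polynomial.separable_X_pow_sub_C (1 : ℂ) (by exact_mod_cast hN) one_ne_zero).squarefree
  have := (Submodule.mem_iInf _).1 hψ i
  rw [hss.isFinitelySemisimple.maxGenEigenspace_eq_eigenspace] at this
  exact Module.End.mem_eigenspace_iff.1 this

/-! ### Stabilizer codes from isotropic subgroups -/

/-- A subgroup `D` of `F ^ n × F ^ n` which is isotropic for the symplectic form gives a stabilizer
code of dimension `q ^ n / |D|`, and an error whose compression to the code is not zero lies in
the symplectic dual of `D`. -/
theorem exists_stabilizerCode_of_isotropic (p : ℕ) [Fact p.Prime] {F : Type*} [Field F]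
    [Algebra (ZMod p) F] [Fintype F] {n : ℕ} (D : AddSubgroup ((Fin n → F) × (Fin n → F)))
    (hD : ∀ u ∈ D, ∀ v ∈ D, chi p (symp u v) = 1) :
    ∃ Q : Submodule ℂ (QSpace F n), IsStabilizerCode p Q ∧
      Module.finrank ℂ Q * Nat.card D = Fintype.card F ^ n ∧
      ∀ u : (Fin n → F) × (Fin n → F), ¬ Annihilates p Q u.1 u.2 →
        ∀ v ∈ D, chi p (symp v u) = 1 := by
  classical
  obtain ⟨ψ, l, hψ, hl⟩ := exists_joint_eigenvector (fun u : D => weyl p u.1)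
    (fun u v => by
      have := weyl_mul_comm p u.1 v.1
      rwa [hD u u.2 v v.2, one_smul] at this)
    (phaseOrder_ne_zero p) (fun u => weyl_pow_phaseOrder p u.1)
  have hphase (u : D) : l u ^ phaseOrder p = 1 := by
    have h : ∀ k : ℕ, (weyl p u.1 ^ k) ψ = l u ^ k • ψ := by
      intro k
      induction k with
      | zero => simp
      | succ k ih => rw [pow_succ, Module.End.mul_apply, hl, map_smul, ih, smul_smul, pow_succ']
    have h1 := h (phaseOrder p)
    rw [weyl_pow_phaseOrder, Module.End.one_apply] at h1
    exact (smul_left_injective ℂ hψ (by simpa using h1)).symm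
  have hl0 (u : D) : l u ≠ 0 := fun h => by
    have := hphase u
    rw [h, zero_pow (phaseOrder_ne_zero p)] at this
    exact zero_ne_one this
  have hlnorm (u : D) : ‖l u‖ = 1 :=
    Complex.norm_eq_one_of_pow_eq_one (hphase u) (phaseOrder_ne_zero p)
  have hlmul (u v : D) : l u * l v = chi p (∑ i, u.1.2 i * v.1.1 i) * l (u + v) := by
    have h1 : (weyl p u.1 * weyl p v.1) ψ = (l u * l v) • ψ := by
      rw [Module.End.mul_apply, hl, map_smul, hl, smul_smul, mul_comm]
    have h2 := hl (u + v)
    rw [weyl_mul, LinearMap.smul_apply, ← AddSubgroup.coe_add, h2, smul_smul] at h1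
    exact (smul_left_injective ℂ hψ h1).symm
  have hlone : l 0 = 1 := by
    have := hl 0
    rw [AddSubgroup.coe_zero, weyl_zero, Module.End.one_apply] at this
    exact (smul_left_injective ℂ hψ (by simpa using this)).symm
  -- Dividing each `weyl p u` by its eigenvalue on `ψ` turns the projective representation of
  -- `D` into a linear one that fixes `ψ`.
  let W : Representation ℂ (Multiplicative D) (QSpace F n) :=
    { toFun := fun u => (l u.toAdd)⁻¹ • weyl p u.toAdd.1
      map_one' := by
        simp [hlone, weyl_zero]
      map_mul' := fun u v => by
        rw [smul_mul_smul_comm, weyl_mul, smul_smul, ← mul_inv, hlmul, mul_inv, toAdd_mul,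
          AddSubgroup.coe_add, mul_right_comm, inv_mul_cancel₀ (chi_ne_zero p _), one_mul] }
  have hW (u : D) : W (Multiplicative.ofAdd u) = (l u)⁻¹ • weyl p u.1 := rfl
  have hQ (v : QSpace F n) : v ∈ W.invariants ↔ ∀ u : D, weyl p u.1 v = l u • v := by
    rw [Representation.mem_invariants]
    refine ⟨fun h u => ?_, fun h u => ?_⟩
    · have := h (Multiplicative.ofAdd u)
      rw [hW, LinearMap.smul_apply] at this
      rw [← this, smul_smul, mul_inv_cancel₀ (hl0 u), one_smul, this]
    · change (l u.toAdd)⁻¹ • weyl p u.toAdd.1 v = v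
      rw [h, smul_smul, inv_mul_cancel₀ (hl0 _), one_smul]
  refine ⟨W.invariants, ⟨?_, ?_⟩, ?_, ?_⟩
  · exact (Submodule.ne_bot_iff _).2 ⟨ψ, (hQ ψ).2 hl, hψ⟩
  · let G : Multiplicative D →* (QSpace F n ≃ₗ[ℂ] QSpace F n) :=
      (LinearMap.GeneralLinearGroup.generalLinearEquiv ℂ (QSpace F n)).toMonoidHom.comp W.toHomUnits
    have hG (u : Multiplicative D) (v : QSpace F n) : G u v = W u v := rfl
    refine ⟨G.range, ?_, ?_, ?_⟩
    · rintro _ ⟨u, rfl⟩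
      refine ⟨(l u.toAdd)⁻¹, u.toAdd.1.1, u.toAdd.1.2, ?_, fun v => rfl⟩
      change (l u.toAdd)⁻¹ ^ phaseOrder p = 1
      rw [inv_pow, hphase, inv_one]
    · rintro _ ⟨u, rfl⟩ _ ⟨v, rfl⟩
      rw [← map_mul, ← map_mul, mul_comm]
    · intro v
      rw [Representation.mem_invariants]
      refine ⟨?_, fun h u => h (G u) ⟨u, rfl⟩⟩
      rintro h _ ⟨u, rfl⟩
      exact h u
  · have hcard : (Nat.card (Multiplicative D) : ℂ) ≠ 0 := by
      exact_mod_cast Nat.card_pos.ne'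
    have htr := W.card_inv_mul_sum_char_eq_finrank
    simp only [Representation.character] at htr
    rw [Finset.sum_eq_single 1, map_one, LinearMap.trace_one, finrank_euclideanSpace,
      inv_mul_eq_iff_eq_mul₀ hcard, Fintype.card_fun, Fintype.card_fin] at htr
    · rw [mul_comm]
      exact_mod_cast htr.symm
    · intro u _ hu
      have : u.toAdd.1 ≠ 0 := fun h => hu (by
        apply Multiplicative.toAdd.injective
        exact Subtype.ext h)
      change LinearMap.trace ℂ _ ((l u.toAdd)⁻¹ • weyl p u.toAdd.1) = 0
      rw [map_smul, trace_weyl p this, smul_zero]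
    · simp
  · intro u hu v hv
    by_contra hne
    refine hu fun φ hφ χ hχ => ?_
    have h1 := inner_weyl_weyl p v φ (weyl p u χ)
    have h2 := congrArg (fun T => T χ) (weyl_mul_comm p v u)
    simp only [Module.End.mul_apply, LinearMap.smul_apply] at h2
    rw [h2, (hQ φ).1 hφ ⟨v, hv⟩, (hQ χ).1 hχ ⟨v, hv⟩, map_smul, inner_smul_left,
      inner_smul_right, inner_smul_right] at h1
    have h3 : (starRingEnd ℂ) (l ⟨v, hv⟩) * l ⟨v, hv⟩ = 1 := by
      rw [Complex.conj_mul', hlnorm]; simp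
    have h4 : (chi p (symp v u) - 1) * inner ℂ φ (weyl p u χ) = 0 := by
      linear_combination h1 - chi p (symp v u) * inner ℂ φ (weyl p u χ) * h3
    exact (mul_eq_zero.1 h4).resolve_left (sub_ne_zero.2 hne)

/-! ### Hermitian self-orthogonal codes and the puncture code -/

section Hermitian

variable {F K : Type*} [Field F] [Field K] [Algebra F K]

/-- The pair `(a, b)` of vectors over `F` is encoded as the vector `a + θ b` over `K`. -/
def pairHom (θ : K) (n : ℕ) : (Fin n → F) × (Fin n → F) →+ (Fin n → K) where
  toFun u := fun i => algebraMap F K (u.1 i) + algebraMap F K (u.2 i) * θ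
  map_zero' := by ext; simp
  map_add' u v := by ext; simp; ring

lemma pairHom_apply (θ : K) {n : ℕ} (u : (Fin n → F) × (Fin n → F)) (i : Fin n) :
    pairHom θ n u i = algebraMap F K (u.1 i) + algebraMap F K (u.2 i) * θ := rfl

variable [Fintype F]

lemma pair_eq_zero_iff {θ : K} (hθ : θ ^ Fintype.card F ≠ θ) (a b : F) :
    algebraMap F K a + algebraMap F K b * θ = 0 ↔ a = 0 ∧ b = 0 := by
  refine ⟨fun h => ?_, by rintro ⟨rfl, rfl⟩; simp⟩
  have h1 := congrArg (FiniteField.frobeniusAlgHom F K) h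
  rw [map_add, map_mul, map_zero, AlgHom.commutes, AlgHom.commutes] at h1
  have h2 : algebraMap F K b * (FiniteField.frobeniusAlgHom F K θ - θ) = 0 := by
    linear_combination h1 - h
  have hb : b = 0 := by
    simpa using (mul_eq_zero.1 h2).resolve_right (sub_ne_zero.2 hθ)
  subst hb
  simpa using h

variable [Fintype K]

lemma finrank_eq_two (hK : Fintype.card K = Fintype.card F ^ 2) : Module.finrank F K = 2 := by
  have h := Module.card_eq_pow_finrank (K := F) (V := K)
  rw [hK] at h
  exact (Nat.pow_right_injective Fintype.one_lt_card h).symm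

lemma exists_pow_card_ne (hK : Fintype.card K = Fintype.card F ^ 2) :
    ∃ θ : K, θ ^ Fintype.card F ≠ θ := by
  by_contra! h
  have h1 : FiniteField.frobeniusAlgHom F K = 1 := AlgHom.ext h
  have h2 := FiniteField.orderOf_frobeniusAlgHom F K
  rw [h1, orderOf_one, finrank_eq_two hK] at h2
  omega

lemma exists_pow_card_add_one_eq (hK : Fintype.card K = Fintype.card F ^ 2) (x : F) :
    ∃ c : K, c ^ (Fintype.card F + 1) = algebraMap F K x := by
  obtain ⟨c, hc⟩ := FiniteField.norm_surjective F K x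
  refine ⟨c, ?_⟩
  rw [← hc, FiniteField.algebraMap_norm_eq_pow_sum, finrank_eq_two hK]
  simp [Finset.sum_range_succ, add_comm]

lemma pairHom_bijective (hK : Fintype.card K = Fintype.card F ^ 2) {θ : K}
    (hθ : θ ^ Fintype.card F ≠ θ) (n : ℕ) : Function.Bijective (pairHom (F := F) θ n) := by
  classical
  rw [Fintype.bijective_iff_injective_and_card]
  refine ⟨(injective_iff_map_eq_zero _).2 fun u hu => ?_, ?_⟩
  · have h (i : Fin n) := (pair_eq_zero_iff hθ _ _).1 (congrFun hu i)
    exact Prod.ext (funext fun i => (h i).1) (funext fun i => (h i).2)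
  · simp [hK]
    ring

/-- The Hermitian form on `K ^ n` minus its conjugate is, up to a constant, the symplectic form on
pairs. -/
lemma hermitian_sub_conj (hK : Fintype.card K = Fintype.card F ^ 2) (θ : K) {n : ℕ}
    (u v : (Fin n → F) × (Fin n → F)) :
    ∑ i, pairHom θ n u i * pairHom θ n v i ^ Fintype.card F -
      (∑ i, pairHom θ n u i * pairHom θ n v i ^ Fintype.card F) ^ Fintype.card F =
    algebraMap F K (symp u v) * (θ - θ ^ Fintype.card F) := by
  have hσ (x : K) : x ^ Fintype.card F = FiniteField.frobeniusAlgHom F K x := rfl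
  have h2 (x : K) :
      FiniteField.frobeniusAlgHom F K (FiniteField.frobeniusAlgHom F K x) = x := by
    change (x ^ Fintype.card F) ^ Fintype.card F = x
    rw [← pow_mul, ← sq, ← hK, FiniteField.pow_card]
  rw [hσ (∑ i, _), map_sum, ← Finset.sum_sub_distrib, symp, ← Finset.sum_sub_distrib, map_sum,
    Finset.sum_mul]
  refine Finset.sum_congr rfl fun i _ => ?_
  simp only [hσ, map_mul, h2, pairHom_apply, map_add, AlgHom.commutes, map_sub]
  ring

lemma eq_zero_of_forall_trace_mul (y : K) (h : ∀ x : K, Algebra.trace F K (x * y) = 0) :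
    y = 0 := by
  have : FiniteDimensional F K := Module.Finite.of_finite
  exact (traceForm_nondegenerate F K).2 y h

/-- A Hermitian self-orthogonal code of length `n` over `K` gives a stabilizer code, whose
undetected errors come from the Hermitian dual. -/
theorem exists_stabilizerCode_of_hermitian (p : ℕ) [Fact p.Prime] [Algebra (ZMod p) F]
    (hK : Fintype.card K = Fintype.card F ^ 2) {θ : K} (hθ : θ ^ Fintype.card F ≠ θ) {n : ℕ}
    (C : Submodule K (Fin n → K))
    (hC : ∀ v ∈ C, ∀ w ∈ C, ∑ i, v i * w i ^ Fintype.card F = 0) :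
    ∃ Q : Submodule ℂ (QSpace F n), IsStabilizerCode p Q ∧
      Module.finrank ℂ Q * Nat.card C = Fintype.card F ^ n ∧
      ∀ u : (Fin n → F) × (Fin n → F), ¬ Annihilates p Q u.1 u.2 →
        ∀ w ∈ C, ∑ i, w i * pairHom θ n u i ^ Fintype.card F = 0 := by
  have hbij := pairHom_bijective hK hθ n
  have hθ' : θ - θ ^ Fintype.card F ≠ 0 := sub_ne_zero.2 hθ.symm
  obtain ⟨Q, hQ, hdim, hann⟩ := exists_stabilizerCode_of_isotropic p
    (C.toAddSubgroup.comap (pairHom θ n)) (fun u hu v hv => by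
      have h := hermitian_sub_conj hK θ u v
      rw [hC _ hu _ hv, zero_pow Fintype.card_ne_zero, sub_zero] at h
      have h0 : symp u v = 0 := by
        simpa using (mul_eq_zero.1 h.symm).resolve_right hθ'
      rw [h0, chi_zero])
  refine ⟨Q, hQ, ?_, fun u hu w hw => ?_⟩
  · rw [← hdim]
    congr 1
    exact (Nat.card_congr ((Equiv.ofBijective _ hbij).subtypeEquiv fun _ => Iff.rfl)).symm
  · -- The symplectic form with `u` vanishes on the code, not only its character values.
    have hsymp (v : (Fin n → F) × (Fin n → F)) (hv : pairHom θ n v ∈ C) : symp v u = 0 := by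
      have : FiniteDimensional (ZMod p) F := Module.Finite.of_finite
      refine (traceForm_nondegenerate (ZMod p) F).2 _ fun c => ?_
      have hcv : pairHom θ n (c • v) ∈ C := by
        have : pairHom θ n (c • v) = algebraMap F K c • pairHom θ n v := by
          ext i
          simp [pairHom_apply]
          ring
        rw [this]
        exact C.smul_mem _ hv
      have h := (chi_eq_one_iff p _).1 (hann u hu (c • v) hcv)
      have hs : symp (c • v) u = c * symp v u := by
        simp [symp, mul_sub, Finset.mul_sum, mul_assoc, mul_left_comm]
      rwa [hs] at h
    -- Hence the Hermitian form takes values in `F`, and by `K`-linearity it vanishes.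
    have hfix (w : Fin n → K) (hw : w ∈ C) :
        ∑ i, w i * pairHom θ n u i ^ Fintype.card F =
          (∑ i, w i * pairHom θ n u i ^ Fintype.card F) ^ Fintype.card F := by
      obtain ⟨v, rfl⟩ := hbij.2 w
      have h := hermitian_sub_conj hK θ v u
      rw [hsymp v hw, map_zero, zero_mul] at h
      exact sub_eq_zero.1 h
    have h1 := hfix w hw
    have h2 := hfix (θ • w) (C.smul_mem _ hw)
    simp only [Pi.smul_apply, smul_eq_mul, mul_assoc, ← Finset.mul_sum, mul_pow, ← h1] at h2
    have h3 : (θ - θ ^ Fintype.card F) * ∑ i, w i * pairHom θ n u i ^ Fintype.card F = 0 := by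
      linear_combination h2
    exact (mul_eq_zero.1 h3).resolve_left hθ'

end Hermitian

section PunctureCode

lemma mul_pow_mem_grm {K : Type*} [Field K] {m ν μ k : ℕ} (h : (k + 1) * ν ≤ μ) {a b : (Fin m → K) → K}
    (ha : a ∈ grm K ν m) (hb : b ∈ grm K ν m) :
    (fun P => a P * b P ^ k) ∈ grm K μ m := by
  obtain ⟨f, hf, rfl⟩ := ha
  obtain ⟨g, hg, rfl⟩ := hb
  refine ⟨f * g ^ k, ?_, by ext P; simp [ev]⟩
  simp only [SetLike.mem_coe, MvPolynomial.mem_restrictTotalDegree] at hf hg ⊢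
  have h1 := MvPolynomial.totalDegree_mul f (g ^ k)
  have h2 := MvPolynomial.totalDegree_pow g k
  nlinarith [Nat.mul_le_mul_left k hg]

variable {F K : Type*} [Field F] [Fintype F] [Field K] [Fintype K] [Algebra F K]

/-- For `y` in the subfield subcode, `y` pairs with `tr (a * b ^ q)` to the trace of the pairing of
`y` with `a * b ^ q`, which is a word of order at most `(q + 1) * ν`. -/
theorem subfieldSubcode_dual_le_hermitianPunctureCode {m ν μ : ℕ}
    (h : (Fintype.card F + 1) * ν ≤ μ) :
    subfieldSubcode F (dual (grm K μ m : Set ((Fin m → K) → K))) ≤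
      hermitianPunctureCode F (grm K ν m) := by
  rintro y hy _ ⟨a, ha, b, hb, rfl⟩
  have h0 := congrArg (Algebra.trace F K) (hy _ (mul_pow_mem_grm h ha hb))
  rw [map_zero, map_sum] at h0
  rw [← h0]
  refine Finset.sum_congr rfl fun P _ => ?_
  change y P * _ = Algebra.trace F K (algebraMap F K (y P) * _)
  rw [← Algebra.smul_def, map_smul, smul_eq_mul]

/-- As `C` is linear over `K`, the traces can be dropped from the definition of the puncture
code. -/
lemma sum_mul_eq_zero_of_mem_hermitianPunctureCode {ι : Type*} [Fintype ι]
    {C : Submodule K (ι → K)} {x : ι → F} (hx : x ∈ hermitianPunctureCode F C)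
    {a b : ι → K} (ha : a ∈ C) (hb : b ∈ C) :
    ∑ i, algebraMap F K (x i) * (a i * b i ^ Fintype.card F) = 0 := by
  refine eq_zero_of_forall_trace_mul (F := F) _ fun k => ?_
  have h := hx _ ⟨k • a, C.smul_mem k ha, b, hb, rfl⟩
  rw [Finset.mul_sum, map_sum, ← h]
  refine Finset.sum_congr rfl fun i _ => ?_
  rw [mul_left_comm, ← Algebra.smul_def, map_smul, smul_eq_mul, Pi.smul_apply, smul_eq_mul,
    mul_assoc]

lemma finrank_grm_le_grmDim (m ν : ℕ) :
    (Module.finrank K (grm K ν m) : ℤ) ≤ grmDim (Fintype.card K) m ν := by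
  rw [← card_reducedExponents]
  exact_mod_cast finrank_grm_le_card m ν

/-- A word `x` of weight `r` in the puncture code gives a stabilizer code of length `r`: writing its
nonzero entries as norms `c ^ (q + 1)` makes the code, restricted to the support of `x` and rescaled
by the `c`, self-orthogonal for the Hermitian form. -/
theorem exists_stabilizerCode_of_mem_punctureCode (p : ℕ) [Fact p.Prime] [Algebra (ZMod p) F]
    [DecidableEq F] (hK : Fintype.card K = Fintype.card F ^ 2) {m ν r : ℕ} {x : (Fin m → K) → F}
    (hx : x ∈ hermitianPunctureCode F (grm K ν m)) (hr : hammingNorm x = r) :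
    ∃ (k : ℕ) (d : ℕ∞),
      (r : ℤ) - 2 * grmDim (Fintype.card K) m ν ≤ k ∧
      (sepBound (Fintype.card K) (ν + 1) : ℕ∞) ≤ d ∧ ExistsStabilizerCode p F r k d := by
  classical
  obtain ⟨θ, hθ⟩ := exists_pow_card_ne hK
  set S : Finset (Fin m → K) := Finset.univ.filter fun P => x P ≠ 0 with hS
  have e : Fin r ≃ S := (Finset.equivFinOfCardEq hr).symm
  set pts : Fin r → Fin m → K := fun i => e i with hpts
  have hinj : Function.Injective pts := Subtype.val_injective.comp e.injective
  have hx0 (i : Fin r) : x (pts i) ≠ 0 := (Finset.mem_filter.1 (e i).2).2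
  choose c hc using fun i => exists_pow_card_add_one_eq (K := K) hK (x (pts i))
  have hc0 (i : Fin r) : c i ≠ 0 := fun h => by
    have := hc i
    rw [h, zero_pow (Nat.succ_ne_zero _)] at this
    exact hx0 i (by simpa using this.symm)
  -- The code `C`, restricted to the support of `x` and rescaled by the `c i`.
  let T : ((Fin m → K) → K) →ₗ[K] (Fin r → K) :=
    LinearMap.pi fun i => c i • LinearMap.proj (pts i)
  have hT (a : (Fin m → K) → K) (i : Fin r) : T a i = c i * a (pts i) := rfl
  obtain ⟨Q, hQ, hdim, hann⟩ := exists_stabilizerCode_of_hermitian p hK hθ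
    ((grm K ν m).map T) (by
      rintro _ ⟨a, ha, rfl⟩ _ ⟨b, hb, rfl⟩
      rw [← sum_mul_eq_zero_of_mem_hermitianPunctureCode hx ha hb]
      rw [← Finset.sum_subset (Finset.subset_univ S), ← Finset.sum_coe_sort S, ← e.sum_comp]
      · refine Finset.sum_congr rfl fun i _ => ?_
        rw [hT, hT, ← hc]
        ring
      · intro P _ hP
        have : x P = 0 := by simpa [hS] using hP
        simp [this])
  set D := Module.finrank K ((grm K ν m).map T) with hD
  have hcard : Nat.card ((grm K ν m).map T) = Fintype.card F ^ (2 * D) := by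
    rw [Module.natCard_eq_pow_finrank (K := K), Nat.card_eq_fintype_card, hK, ← pow_mul]
  rw [hcard] at hdim
  have hF1 : 1 < Fintype.card F := Fintype.one_lt_card
  have h2D : 2 * D ≤ r := (Nat.pow_dvd_pow_iff_le_right hF1).1 (Dvd.intro_left _ hdim)
  -- The subtraction is not truncated, by `h2D`.
  refine ⟨r - 2 * D, minDist p Q, ?_, ?_, Q, hQ, ?_, rfl⟩
  · have h1 : D ≤ Module.finrank K (grm K ν m) := Submodule.finrank_map_le _ _
    have h2 := finrank_grm_le_grmDim (K := K) m ν
    omega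
  · refine le_iInf fun a => le_iInf fun b => le_iInf fun hbad => ?_
    -- In both branches of the definition of the minimum distance, the error is nontrivial and its
    -- compression to the code is not zero.
    have hab : (a ≠ 0 ∨ b ≠ 0) ∧ ¬ Annihilates p Q a b := by
      rcases hbad with ⟨_, h⟩ | ⟨_, h⟩
      · refine ⟨?_, fun h' => h ⟨0, fun u hu v hv => by rw [h' u hu v hv, zero_mul]⟩⟩
        by_contra! h'
        obtain ⟨rfl, rfl⟩ := h'
        refine h ⟨1, fun u _ v _ => ?_⟩
        have : errorOp p (0 : Fin r → F) 0 v = v := by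
          change weyl p 0 v = v
          rw [weyl_zero, Module.End.one_apply]
        rw [this, one_mul]
      · exact h
    have hz (i : Fin r) :
        c i * pairHom θ r (a, b) i ^ Fintype.card F ≠ 0 ↔ a i ≠ 0 ∨ b i ≠ 0 := by
      rw [mul_ne_zero_iff_left (hc0 i), pow_ne_zero_iff Fintype.card_ne_zero, pairHom_apply, Ne,
        pair_eq_zero_iff hθ, not_and_or]
    have := sepBound_le_card (ν := ν) hinj
      (y := fun i => c i * pairHom θ r (a, b) i ^ Fintype.card F) ?_ ?_
    · rw [errorWeight]
      simp only [hz] at this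
      exact_mod_cast this
    · obtain ⟨i, hi⟩ : ∃ i, a i ≠ 0 ∨ b i ≠ 0 := by
        rcases hab.1 with h | h
        · obtain ⟨i, hi⟩ := Function.ne_iff.1 h
          exact ⟨i, Or.inl hi⟩
        · obtain ⟨i, hi⟩ := Function.ne_iff.1 h
          exact ⟨i, Or.inr hi⟩
      exact fun h => (hz i).2 hi (congrFun h i)
    · intro s hs
      rw [← hann (a, b) hab.2 (T s) ⟨s, hs, rfl⟩]
      refine Finset.sum_congr rfl fun i _ => ?_
      rw [hT]
      ring
  · have hpos : 0 < Fintype.card F ^ (2 * D) := pow_pos (by omega) _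
    refine Nat.eq_of_mul_eq_mul_right hpos ?_
    rw [hdim, ← pow_add, Nat.sub_add_cancel h2D]

end PunctureCode

end QuantumGRM

end

theorem theorem4 {p : ℕ} [Fact p.Prime] {F K : Type*} [Field F] [Fintype F] [DecidableEq F]
    [Algebra (ZMod p) F] [Field K] [Fintype K] [Algebra F K]
    (q : ℕ) (hF : Fintype.card F = q) (hK : Fintype.card K = q ^ 2)
    (m ν μ : ℕ) (hν : (ν : ℤ) ≤ m * ((q : ℤ) - 1) - 1)
    (hμ₁ : (q + 1) * ν ≤ μ) (hμ₂ : (μ : ℤ) ≤ m * ((q : ℤ) ^ 2 - 1) - 1) :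
    QuantumGRM.subfieldSubcode F
        (QuantumGRM.dual (QuantumGRM.grm K μ m : Set ((Fin m → K) → K))) ≤
      QuantumGRM.hermitianPunctureCode F (QuantumGRM.grm K ν m) ∧
    ∀ r : ℕ,
      (∃ x ∈ QuantumGRM.hermitianPunctureCode F (QuantumGRM.grm K ν m), hammingNorm x = r) →
      ∃ (k : ℕ) (d : ℕ∞),
        (r : ℤ) - 2 * QuantumGRM.grmDim (q ^ 2) m ν ≤ k ∧
        (QuantumGRM.grmDist (q ^ 2) m (QuantumGRM.dualOrder (q ^ 2) m ν) : ℕ∞) ≤ d ∧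
        QuantumGRM.ExistsStabilizerCode p F r k d := by
  subst hF
  refine ⟨QuantumGRM.subfieldSubcode_dual_le_hermitianPunctureCode hμ₁, ?_⟩
  rintro r ⟨x, hx, hr⟩
  have hν' : ν + 1 ≤ m * (Fintype.card F ^ 2 - 1) := by
    have hF1 : 1 < Fintype.card F := Fintype.one_lt_card
    have h1 : ν + 1 ≤ m * (Fintype.card F - 1) := by
      zify [hF1.le]
      linarith
    refine h1.trans (Nat.mul_le_mul_left _ (Nat.sub_le_sub_right ?_ _))
    exact Nat.le_self_pow two_ne_zero _
  rw [QuantumGRM.grmDist_dualOrder hν', ← hK]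
  exact QuantumGRM.exists_stabilizerCode_of_mem_punctureCode p hK hx hr
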